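/- Let $\gamma,\kappa,m,Z$ be natural numbers with $Z\ge 1$, $\gamma,\kappa\ge 2$ and $(\gamma,\kappa)\neq(2,2)$ (equivalently $\gamma\kappa-\gamma-\kappa\ge 1$), and let $L_c$ be any coupling length. A partition matrix $\mathbf P\in\{0,\dots,m\}^{\gamma\times\kappa}$ splits the all-one $\gamma\times\kappa$ base matrix into components $\mathbf H_0,\dots,\mathbf H_m$, where $\mathbf H_\ell(i,j)=1$ if $\mathbf P(i,j)=\ell$ and $\mathbf H_\ell(i,j)=0$ otherwise. The coupled protograph has row blocks $0,\dots,m+L_c-1$ and column blocks $0,\dots,L_c-1$; its block in position $(r,t)$ is $\mathbf H_{r-t}$ if $0\le r-t\le m$ and $0$ otherwise. Given a lifting matrix $\mathbf L\in\mathbb Z_Z^{\gamma\times\kappa}$, the parity-check matrix of the QC-SC-LDPC code of $(\mathbf P,\mathbf L)$ is obtained by replacing each $1$ that comes from the base entry $(i,j)$ by $\sigma^{\mathbf L(i,j)}$, where $\sigma$ is the $Z\times Z$ identity matrix cyclically shifted left by one step, and each $0$ by the $Z\times Z$ zero matrix. Its Tanner graph is the bipartite graph with the rows and columns of this matrix as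 vertices and its nonzero entries as edges. A 4-cycle candidate $c_4=(j_1,i_1,j_2,i_2)\in\mathcal C_4$ consists of two distinct columns $j_1\ne j_2$ and two distinct rows $i_1\neq i_2$ of the base matrix. It is active for $(\mathbf P,\mathbf L)$ if the Tanner graph contains a 4-cycle lying over $j_1,i_1,j_2,i_2$. (For $L_c\ge m+1$ this means that $\mathbf P(i_1,j_1)+\mathbf P(i_2,j_2)=\mathbf P(i_1,j_2)+\mathbf P(i_2,j_1)$ and $\mathbf L(i_1,j_1)+\mathbf L(i_2,j_2)\equiv\mathbf L(i_1,j_2)+\mathbf L(i_2,j_1)\pmod Z$.) Let $\#\big(\bigcap_{c_4\in\mathcal C_4}\overline{c_4}\big)$ be the number of pairs $(\mathbf P,\mathbf L)$ for which no 4-cycle candidate is active. Put $\Delta=(2\gamma-3)(2\kappa-3)$, $\mathrm{I}=\dfrac{(\Delta-1)^{\Delta-1}}{\Delta^{\Delta}}$ and $\mathrm{II}=\dfrac{27}{256(\gamma\kappa-\gamma-\kappa)}$. If $$\frac{2m^2+4m+3}{3(m+1)^3Z}\le\max\{\mathrm{I},\mathrm{II}\}$$ (the left side is the probability that the two conditions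 above hold for a given candidate when all entries of $\mathbf P$ and $\mathbf L$ are independent and uniform), then $$\#\Big(\bigcap_{c_4\in\mathcal C_4}\overline{c_4}\Big)\ \ge\ [Z(m+1)]^{\gamma\kappa}\times\begin{cases}\left(1-\dfrac{2}{\Delta}\right)^{\binom{\gamma}{2}\binom{\kappa}{2}}, & \text{if } \mathrm{I}>\mathrm{II},\\[2mm] \left(1-\dfrac{\gamma\kappa-\gamma-\kappa+1}{4(\gamma\kappa-\gamma-\kappa)}\right)^{\gamma\kappa}, & \text{otherwise.}\end{cases}$$ -/

import Mathlib

namespace QCSC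

/-- A partition matrix: entry `(i, j)` says which of the component matrices `H_0, …, H_m`
receives the edge `(i, j)` of the all-one `γ × κ` base matrix. -/
abbrev PartitionMatrix (γ κ m : ℕ) := Matrix (Fin γ) (Fin κ) (Fin (m + 1))

/-- A lifting matrix: a circulant power in `{0, …, Z - 1}` for each edge of the base matrix. -/
abbrev LiftingMatrix (γ κ Z : ℕ) := Matrix (Fin γ) (Fin κ) (ZMod Z)

/-- The component matrix `H_ℓ` of the edge spreading recorded by `P`. -/
def componentMatrix {γ κ m : ℕ} (P : PartitionMatrix γ κ m) (l : Fin (m + 1)) :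
    Matrix (Fin γ) (Fin κ) (ZMod 2) :=
  Matrix.of fun i j => if P i j = l then 1 else 0

/-- The coupled protograph matrix with coupling length `Lc`. Column block `t` is a replica (the
stack of `H_0, …, H_m`) starting at row block `t`, so block `(r, t)` is `H_ℓ` if `r = t + ℓ`
with `0 ≤ ℓ ≤ m`, and zero otherwise. -/
def coupledProtograph {γ κ m : ℕ} (Lc : ℕ) (P : PartitionMatrix γ κ m) :
    Matrix (Fin (m + Lc) × Fin γ) (Fin Lc × Fin κ) (ZMod 2) :=
  Matrix.of fun a b => ∑ l : Fin (m + 1),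
    if (a.1 : ℕ) = (b.1 : ℕ) + (l : ℕ) then componentMatrix P l a.2 b.2 else 0

/-- The `Z × Z` circulant permutation matrix obtained from the identity by a one-step left
cyclic shift. -/
def circulantShift (Z : ℕ) : Matrix (ZMod Z) (ZMod Z) (ZMod 2) :=
  Matrix.of fun x y => if x = y + 1 then 1 else 0

/-- Check nodes: row block, row of the base matrix, row inside the circulant. -/
abbrev CheckNode (γ m Z Lc : ℕ) := (Fin (m + Lc) × Fin γ) × ZMod Z

/-- Variable nodes: column block, column of the base matrix, column inside the circulant. -/
abbrev VarNode (κ Z Lc : ℕ) := (Fin Lc × Fin κ) × ZMod Z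

/-- The parity-check matrix of the QC-SC-LDPC code given by `(P, L)` and the coupling length `Lc`:
every `1` of the coupled protograph coming from the base edge `(i, j)` is replaced by
`σ ^ L(i, j)`, and every `0` by the zero block. -/
def parityCheck {γ κ m Z : ℕ} [NeZero Z] (Lc : ℕ) (P : PartitionMatrix γ κ m)
    (L : LiftingMatrix γ κ Z) : Matrix (CheckNode γ m Z Lc) (VarNode κ Z Lc) (ZMod 2) :=
  Matrix.of fun a b =>
    coupledProtograph Lc P a.1 b.1 * (circulantShift Z ^ (L a.1.2 b.1.2).val) a.2 b.2

/-- The Tanner graph of a parity-check matrix: rows are check nodes, columns are variable nodes. -/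
def tannerGraph {R C : Type*} (H : Matrix R C (ZMod 2)) : SimpleGraph (R ⊕ C) :=
  SimpleGraph.fromRel fun u v => ∃ r c, u = Sum.inl r ∧ v = Sum.inr c ∧ H r c = 1

/-- The node of the base graph (rows and columns of the base matrix) below a node of the
Tanner graph. -/
def toBase {γ κ m Z Lc : ℕ} : CheckNode γ m Z Lc ⊕ VarNode κ Z Lc → Fin γ ⊕ Fin κ :=
  Sum.map (fun a => a.1.2) (fun b => b.1.2)

/-- A 4-cycle candidate `(j₁, i₁, j₂, i₂)` in the `γ × κ` base matrix. -/
structure FourCycle (γ κ : ℕ) where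
  j₁ : Fin κ
  i₁ : Fin γ
  j₂ : Fin κ
  i₂ : Fin γ
  hj : j₁ ≠ j₂
  hi : i₁ ≠ i₂

/-- The candidate `c` is active after edge spreading by `P` and `Z`-lifting by `L`: the Tanner
graph has a cycle that runs over the base nodes `j₁, i₁, j₂, i₂` and closes up. -/
def FourCycle.Active {γ κ m Z : ℕ} [NeZero Z] (Lc : ℕ) (P : PartitionMatrix γ κ m)
    (L : LiftingMatrix γ κ Z) (c : FourCycle γ κ) : Prop :=
  ∃ (v : CheckNode γ m Z Lc ⊕ VarNode κ Z Lc) (w : (tannerGraph (parityCheck Lc P L)).Walk v v),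
    w.IsCycle ∧ w.support.map toBase =
      [Sum.inr c.j₁, Sum.inl c.i₁, Sum.inr c.j₂, Sum.inl c.i₂, Sum.inr c.j₁]

/-- The pairs `(P, L)` for which no 4-cycle candidate is active. -/
def feasiblePairs (γ κ m Z Lc : ℕ) [NeZero Z] : Set (PartitionMatrix γ κ m × LiftingMatrix γ κ Z) :=
  {PL | ∀ c : FourCycle γ κ, ¬ c.Active Lc PL.1 PL.2}

/-- `Δ = (2γ - 3)(2κ - 3)`; it is only used for `γ, κ ≥ 2`, where nothing is truncated. -/
def Delta (γ κ : ℕ) : ℕ := (2 * γ - 3) * (2 * κ - 3)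

/-- The threshold `I = (Δ - 1)^(Δ - 1) / Δ^Δ`. -/
noncomputable def thresholdI (γ κ : ℕ) : ℝ :=
  ((Delta γ κ : ℝ) - 1) ^ (Delta γ κ - 1) / (Delta γ κ : ℝ) ^ Delta γ κ

/-- The threshold `II = 27 / (256 (γκ - γ - κ))`. -/
noncomputable def thresholdII (γ κ : ℕ) : ℝ :=
  27 / (256 * ((γ : ℝ) * κ - γ - κ))

end QCSC

/-! Choose all entries of `P` and `L` independently and uniformly, one pair per cell of the base
matrix. An active candidate satisfies its two closing equations, so it is enough to count the
assignments in which no candidate closes. A candidate closes with probability p, the left side of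
the hypothesis, and its event depends only on its four cells; hence it is independent of any family
of candidates sharing no cell with it.

Two forms of the local lemma apply. In `symmetric_local_lemma` a candidate has Δ - 1 neighbours, and
x(1 - x)^(Δ-1) is largest at x = 1/Δ, with value I. In `clique_local_lemma` the labels are the
cells: four per candidate, and N + 1 = (γ-1)(κ-1) candidates per cell, where N = γκ - γ - κ. Then
x(1 - Nx)^3 is largest at x = 1/(4N), with value II. Both forms rest on `pow_mul_card_avoiding_le`,
which removes labels one at a time at a cost of a factor 1 - nx each. -/

/-! ### Local lemmas in counting form. -/

section LocalLemma

variable {Ω V ι : Type*} [Fintype Ω] [DecidableEq Ω]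

/-- The outcomes avoiding every event `A v` with `v ∈ S`. -/
def avoiding (A : V → Finset Ω) (S : Finset V) : Finset Ω :=
  Finset.univ.filter fun ω => ∀ v ∈ S, ω ∉ A v

theorem mem_avoiding {A : V → Finset Ω} {S : Finset V} {ω : Ω} :
    ω ∈ avoiding A S ↔ ∀ v ∈ S, ω ∉ A v := by
  simp [avoiding]

theorem avoiding_anti (A : V → Finset Ω) {S T : Finset V} (h : T ⊆ S) :
    avoiding A S ⊆ avoiding A T := fun _ hω =>
  mem_avoiding.2 fun v hv => mem_avoiding.1 hω v (h hv)

variable [DecidableEq V] [DecidableEq ι]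

/-- An outcome that avoids `T` but not `S` lies in some `A w` with `w ∈ S \ T`; this is the union
bound over those `w`. -/
theorem card_avoiding_union_bound (A : V → Finset Ω) (S T : Finset V) {x : ℝ}
    (h : ∀ w ∈ S \ T, ((A w ∩ avoiding A T).card : ℝ) ≤ x * (avoiding A T).card) :
    (1 - (S \ T).card * x) * ((avoiding A T).card : ℝ) ≤ (avoiding A S).card := by
  have hsub : avoiding A T ⊆
      avoiding A S ∪ (S \ T).biUnion fun w => A w ∩ avoiding A T := by
    intro ω hω
    by_cases hS : ω ∈ avoiding A S
    · exact Finset.mem_union_left _ hS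
    · rw [mem_avoiding] at hS
      push Not at hS
      obtain ⟨w, hw, hωw⟩ := hS
      refine Finset.mem_union_right _ (Finset.mem_biUnion.2 ⟨w, ?_, ?_⟩)
      · exact Finset.mem_sdiff.2 ⟨hw, fun hT => mem_avoiding.1 hω w hT hωw⟩
      · exact Finset.mem_inter.2 ⟨hωw, hω⟩
  have h1 : ((avoiding A T).card : ℝ) ≤ (avoiding A S).card +
      ∑ w ∈ S \ T, ((A w ∩ avoiding A T).card : ℝ) := by
    exact_mod_cast (Finset.card_le_card hsub).trans
      ((Finset.card_union_le _ _).trans (Nat.add_le_add_left Finset.card_biUnion_le _))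
  have h2 := Finset.sum_le_sum h
  rw [Finset.sum_const, nsmul_eq_mul] at h2
  linarith

/-- If every event through a label `j ∈ J` has small probability given the avoidance of events not
carrying the label `j`, then the labels of `J` can be removed one after the other. -/
theorem pow_mul_card_avoiding_le (A : V → Finset Ω) (cl : V → Finset ι) (S : Finset V)
    (J : Finset ι) {n : ℕ} {x : ℝ} (hx : 0 ≤ x) (hnx : n * x ≤ 1)
    (hn : ∀ j ∈ J, (S.filter fun w => j ∈ cl w).card ≤ n)
    (h : ∀ T ⊂ S, ∀ w ∈ S, ∀ j ∈ cl w, (∀ u ∈ T, j ∉ cl u) →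
      ((A w ∩ avoiding A T).card : ℝ) ≤ x * (avoiding A T).card) :
    (1 - n * x) ^ J.card * ((avoiding A (S.filter fun w => Disjoint J (cl w))).card : ℝ) ≤
      (avoiding A S).card := by
  induction J using Finset.induction_on with
  | empty => simp
  | insert j J hj ih =>
    have ih := ih fun i hi => hn i (Finset.mem_insert_of_mem hi)
    refine le_trans ?_ ih
    rw [Finset.card_insert_of_notMem hj, pow_succ, mul_assoc]
    refine mul_le_mul_of_nonneg_left ?_ (pow_nonneg (by linarith) _)
    set T := S.filter fun w => Disjoint J (cl w)
    set T' := S.filter fun w => Disjoint (insert j J) (cl w)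
    have hsub : T \ T' ⊆ S.filter fun w => j ∈ cl w := by
      intro w hw
      simp only [T, T', Finset.mem_sdiff, Finset.mem_filter, Finset.disjoint_insert_left] at hw ⊢
      tauto
    -- Passing from `T` to `T'` drops only events carrying `j`, and nothing left in `T'` carries
    -- `j`, so `h` bounds each dropped event.
    have hb := card_avoiding_union_bound A T T' (x := x) fun w hw => by
      have hw' := Finset.mem_filter.1 (hsub hw)
      refine h T' ?_ w hw'.1 j hw'.2 fun u hu => ?_
      · refine (Finset.ssubset_iff_of_subset (Finset.filter_subset _ _)).2 ⟨w, hw'.1, ?_⟩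
        exact (Finset.mem_sdiff.1 hw).2
      · exact (Finset.disjoint_insert_left.1 (Finset.mem_filter.1 hu).2).1
    refine le_trans (mul_le_mul_of_nonneg_right ?_ (Nat.cast_nonneg _)) hb
    have : ((T \ T').card : ℝ) ≤ n := by
      exact_mod_cast (Finset.card_le_card hsub).trans (hn j (Finset.mem_insert_self _ _))
    nlinarith

/-- The clique form of the local lemma: events carry `k + 1` labels each, every label is carried by
at most `n + 1` events, and events without a common label are independent. -/
theorem clique_local_lemma [Fintype ι] (A : V → Finset Ω) (cl : V → Finset ι) (E : Finset V)
    {n k : ℕ} {x p : ℝ} (hx : 0 ≤ x) (hnx : (n + 1) * x ≤ 1) (hp : p ≤ x * (1 - n * x) ^ k)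
    (hcl : ∀ v ∈ E, (cl v).card = k + 1)
    (hn : ∀ j, (E.filter fun w => j ∈ cl w).card ≤ n + 1)
    (hA : ∀ v ∈ E, ∀ S ⊆ E, (∀ w ∈ S, Disjoint (cl v) (cl w)) →
      ((A v ∩ avoiding A S).card : ℝ) ≤ p * (avoiding A S).card) :
    (1 - (n + 1) * x) ^ Fintype.card ι * (Fintype.card Ω : ℝ) ≤ (avoiding A E).card := by
  have hnx' : n * x ≤ 1 := by linarith
  -- One label of `v` missing from `S` suffices for the bound `x`. Peeling the other `k` labels
  -- leaves events independent of `v`. Each peel costs `n`, not `n + 1`, since `v` itself carries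
  -- the label and is not in `S`.
  have key : ∀ S ⊆ E, ∀ v ∈ E, ∀ i ∈ cl v, (∀ w ∈ S, i ∉ cl w) →
      ((A v ∩ avoiding A S).card : ℝ) ≤ x * (avoiding A S).card := by
    intro S
    induction S using Finset.strongInduction with
    | H S ih =>
    intro hSE v hv i hi hiS
    have hvS : v ∉ S := fun h => hiS v h hi
    have hpeel := pow_mul_card_avoiding_le A cl S ((cl v).erase i) hx hnx'
      (fun j hj => by
        have hv' : v ∈ E.filter fun w => j ∈ cl w :=
          Finset.mem_filter.2 ⟨hv, Finset.mem_of_mem_erase hj⟩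
        have : S.filter (fun w => j ∈ cl w) ⊆ (E.filter fun w => j ∈ cl w).erase v := by
          intro w hw
          rw [Finset.mem_filter] at hw
          refine Finset.mem_erase.2 ⟨fun h => hvS (h ▸ hw.1), ?_⟩
          exact Finset.mem_filter.2 ⟨hSE hw.1, hw.2⟩
        have h1 := Finset.card_le_card this
        rw [Finset.card_erase_of_mem hv'] at h1
        have := hn j
        omega)
      (fun T hT w hw j hj hjT => ih T hT (hT.1.trans hSE) w (hSE hw) j hj hjT)
    rw [Finset.card_erase_of_mem hi, hcl v hv, Nat.add_sub_cancel] at hpeel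
    set S' := S.filter fun w => Disjoint ((cl v).erase i) (cl w)
    have hS' : S' ⊆ S := Finset.filter_subset _ _
    calc ((A v ∩ avoiding A S).card : ℝ) ≤ (A v ∩ avoiding A S').card := by
          exact_mod_cast Finset.card_le_card
            (Finset.inter_subset_inter_left (avoiding_anti A hS'))
      _ ≤ p * (avoiding A S').card := by
          refine hA v hv S' (hS'.trans hSE) fun w hw => ?_
          obtain ⟨hwS, hw⟩ := Finset.mem_filter.1 hw
          rw [← Finset.insert_erase hi, Finset.disjoint_insert_left]
          exact ⟨hiS w hwS, hw⟩
      _ ≤ x * (1 - n * x) ^ k * (avoiding A S').card := by gcongr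
      _ ≤ x * (avoiding A S).card := by
          rw [mul_assoc]
          exact mul_le_mul_of_nonneg_left hpeel hx
  have hfin := pow_mul_card_avoiding_le A cl E Finset.univ (n := n + 1) hx (by exact_mod_cast hnx)
    (fun j _ => hn j) fun T hT w hw j hj hjT => key T hT.1 w hw j hj hjT
  have hempty : (E.filter fun w => Disjoint Finset.univ (cl w)) = ∅ := by
    refine Finset.filter_eq_empty_iff.2 fun w hw hd => ?_
    have h0 : cl w = ∅ := by
      rwa [← Finset.top_eq_univ, top_disjoint, Finset.bot_eq_empty] at hd
    have := hcl w hw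
    simp [h0] at this
  rw [hempty] at hfin
  simpa [avoiding] using hfin

/-- The symmetric local lemma. -/
theorem symmetric_local_lemma (A : V → Finset Ω) (adj : V → V → Prop) [DecidableRel adj]
    (E : Finset V) {d : ℕ} {x p : ℝ} (hx : 0 ≤ x) (hx1 : x ≤ 1) (hp : p ≤ x * (1 - x) ^ d)
    (hd : ∀ v ∈ E, ((E.erase v).filter fun w => adj v w).card ≤ d)
    (hA : ∀ v ∈ E, ∀ S ⊆ E, (∀ w ∈ S, ¬ adj v w) →
      ((A v ∩ avoiding A S).card : ℝ) ≤ p * (avoiding A S).card) :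
    (1 - x) ^ E.card * (Fintype.card Ω : ℝ) ≤ (avoiding A E).card := by
  have hone : ∀ (S : Finset V) (j : V),
      (S.filter fun w => j ∈ ({w} : Finset V)).card ≤ 1 := by
    intro S j
    refine Finset.card_le_one.2 fun a ha b hb => ?_
    simp only [Finset.mem_filter, Finset.mem_singleton] at ha hb
    exact ha.2.symm.trans hb.2
  have key : ∀ S ⊆ E, ∀ v ∈ E, v ∉ S →
      ((A v ∩ avoiding A S).card : ℝ) ≤ x * (avoiding A S).card := by
    intro S
    induction S using Finset.strongInduction with
    | H S ih =>
    intro hSE v hv hvS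
    -- With every event as its own only label, peeling labels removes the neighbours of `v` one by
    -- one.
    have hpeel := pow_mul_card_avoiding_le A (fun w => ({w} : Finset V)) S
      (S.filter fun w => adj v w) (n := 1) hx (by simpa using hx1) (fun j _ => hone S j)
      (fun T hT w hw j hj hjT => ih T hT (hT.1.trans hSE) w (hSE hw) fun hwT => hjT w hwT hj)
    rw [Nat.cast_one, one_mul] at hpeel
    set S' := S.filter fun w => Disjoint (S.filter fun w => adj v w) {w}
    have hS' : S' ⊆ S := Finset.filter_subset _ _
    have hcard : (S.filter fun w => adj v w).card ≤ d := by
      refine (Finset.card_le_card (Finset.filter_subset_filter _ fun w hw => ?_)).trans (hd v hv)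
      exact Finset.mem_erase.2 ⟨fun h => hvS (h ▸ hw), hSE hw⟩
    calc ((A v ∩ avoiding A S).card : ℝ) ≤ (A v ∩ avoiding A S').card := by
          exact_mod_cast Finset.card_le_card
            (Finset.inter_subset_inter_left (avoiding_anti A hS'))
      _ ≤ p * (avoiding A S').card := by
          refine hA v hv S' (hS'.trans hSE) fun w hw hvw => ?_
          obtain ⟨hwS, hw⟩ := Finset.mem_filter.1 hw
          exact Finset.disjoint_singleton_right.1 hw (Finset.mem_filter.2 ⟨hwS, hvw⟩)
      _ ≤ x * (1 - x) ^ d * (avoiding A S').card := by gcongr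
      _ ≤ x * (1 - x) ^ (S.filter fun w => adj v w).card * (avoiding A S').card := by
          gcongr x * ?_ * _
          exact pow_le_pow_of_le_one (by linarith) (by linarith) hcard
      _ ≤ x * (avoiding A S).card := by
          rw [mul_assoc]
          exact mul_le_mul_of_nonneg_left hpeel hx
  have hfin := pow_mul_card_avoiding_le A (fun w => ({w} : Finset V)) E E (n := 1) hx
    (by simpa using hx1) (fun j _ => hone E j)
    fun T hT w hw j hj hjT => key T hT.1 w hw fun hwT => hjT w hwT hj
  have hempty : (E.filter fun w => Disjoint E {w}) = ∅ := by
    refine Finset.filter_eq_empty_iff.2 fun w hw hd => ?_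
    exact Finset.disjoint_singleton_right.1 hd hw
  rw [hempty] at hfin
  simpa [avoiding] using hfin

end LocalLemma

/-! ### Independence in a product space. -/

section ProductSpace

variable {ι α : Type*} [Fintype ι] [DecidableEq ι] [Fintype α]

/-- The proportion of functions whose restriction along an injection satisfies `Q`. -/
theorem card_filter_comp_mul_card {β : Type*} [Fintype β] [DecidableEq β] {e : β → ι}
    (he : Function.Injective e) (Q : (β → α) → Prop) [DecidablePred Q] :
    (Finset.univ.filter fun f : ι → α => Q (f ∘ e)).card * Fintype.card (β → α) =
      (Finset.univ.filter Q).card * Fintype.card (ι → α) := by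
  classical
  let σ : β ⊕ ↥(Set.range e)ᶜ ≃ ι :=
    ((Equiv.ofInjective e he).sumCongr (Equiv.refl _)).trans (Equiv.Set.sumCompl (Set.range e))
  let τ : (ι → α) ≃ (β → α) × (↥(Set.range e)ᶜ → α) :=
    (σ.arrowCongr (Equiv.refl α)).symm.trans (Equiv.sumArrowEquivProdArrow _ _ _)
  have hτ : ∀ f, (τ f).1 = f ∘ e := by
    intro f
    funext b
    simp [τ, σ, Equiv.sumArrowEquivProdArrow]
  have h1 : (Finset.univ.filter fun f : ι → α => Q (f ∘ e)).card =
      (Finset.univ.filter Q).card * Fintype.card (↥(Set.range e)ᶜ → α) := by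
    rw [← Finset.card_univ, ← Finset.card_product]
    refine Finset.card_equiv τ fun f => ?_
    simp [hτ]
  rw [h1, Fintype.card_congr τ, Fintype.card_prod]
  ring

variable [DecidableEq α]

/-- The set `A` of functions depends only on the values on `s`. -/
def DependsOnlyOn (A : Finset (ι → α)) (s : Set ι) : Prop :=
  ∀ f g : ι → α, (∀ i ∈ s, f i = g i) → f ∈ A → g ∈ A

/-- Sets of functions depending on complementary coordinates are independent. -/
theorem card_inter_mul_card_of_dependsOnlyOn {A B : Finset (ι → α)} {s : Finset ι}
    (hA : DependsOnlyOn A s) (hB : DependsOnlyOn B (↑s)ᶜ) :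
    (A ∩ B).card * Fintype.card (ι → α) = A.card * B.card := by
  rw [← Finset.card_univ, ← Finset.card_product, ← Finset.card_product]
  -- Exchanging `f` and `g` off `s` is an involution. For `f ∈ A ∩ B` and any `g`, the first image
  -- agrees with `f` on `s` and the second agrees with `f` off `s`.
  refine Finset.card_nbij' (fun q => (s.piecewise q.1 q.2, s.piecewise q.2 q.1))
    (fun q => (s.piecewise q.1 q.2, s.piecewise q.2 q.1)) ?_ ?_ ?_ ?_
  · rintro ⟨f, g⟩ h
    simp only [Finset.coe_product, Finset.coe_inter, Set.mem_prod, Set.mem_inter_iff,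
      Finset.mem_coe] at h ⊢
    refine ⟨hA f _ (fun i hi => ?_) h.1.1, hB f _ (fun i hi => ?_) h.1.2⟩
    · simp [Finset.piecewise_eq_of_mem _ _ _ (Finset.mem_coe.1 hi)]
    · simp [Finset.piecewise_eq_of_notMem _ _ _ (fun h => hi (Finset.mem_coe.2 h))]
  · rintro ⟨f, g⟩ h
    simp only [Finset.coe_product, Finset.coe_inter, Set.mem_prod, Set.mem_inter_iff,
      Finset.mem_coe] at h ⊢
    refine ⟨⟨hA f _ (fun i hi => ?_) h.1, hB g _ (fun i hi => ?_) h.2⟩, Finset.mem_univ _⟩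
    · simp [Finset.piecewise_eq_of_mem _ _ _ (Finset.mem_coe.1 hi)]
    · simp [Finset.piecewise_eq_of_notMem _ _ _ (fun h => hi (Finset.mem_coe.2 h))]
  all_goals
    rintro ⟨f, g⟩ -
    ext i <;> by_cases hi : i ∈ s <;> simp [hi]

end ProductSpace

/-! ### Counting closing quadruples and pairs of indices. -/

section Counting

theorem card_filter_add_eq (M k : ℕ) :
    (Finset.univ.filter fun q : Fin M × Fin M => k + (q.1 : ℕ) = q.2).card = M - k := by
  rw [← Finset.card_range (M - k)]
  refine Finset.card_bij (fun q _ => (q.1 : ℕ)) ?_ ?_ ?_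
  · rintro ⟨b, d⟩ h
    simp only [Finset.mem_filter, Finset.mem_univ, true_and] at h
    have := d.2
    simp only [Finset.mem_range]
    omega
  · rintro ⟨b, d⟩ h ⟨b', d'⟩ h' hb
    simp only [Finset.mem_filter, Finset.mem_univ, true_and] at h h' hb
    ext <;> simp <;> omega
  · intro b hb
    rw [Finset.mem_range] at hb
    exact ⟨(⟨b, by omega⟩, ⟨k + b, by omega⟩), by simp, rfl⟩

theorem card_filter_add_eq_add (M : ℕ) (a c : Fin M) :
    ((Finset.univ.filter fun q : Fin M × Fin M => (a : ℕ) + q.1 = c + q.2).card : ℤ) =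
      M - |(a : ℤ) - c| := by
  have ha := a.2
  have hc := c.2
  rcases le_total (c : ℕ) a with h | h
  · have e : (Finset.univ.filter fun q : Fin M × Fin M => (a : ℕ) + q.1 = c + q.2) =
        Finset.univ.filter fun q : Fin M × Fin M => ((a : ℕ) - c) + (q.1 : ℕ) = q.2 := by
      ext q
      simp only [Finset.mem_filter, Finset.mem_univ, true_and]
      omega
    rw [e, card_filter_add_eq, abs_of_nonneg (by omega)]
    omega
  · have e : (Finset.univ.filter fun q : Fin M × Fin M => (a : ℕ) + q.1 = c + q.2).card =
        (Finset.univ.filter fun q : Fin M × Fin M => ((c : ℕ) - a) + (q.1 : ℕ) = q.2).card := by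
      refine Finset.card_equiv (Equiv.prodComm _ _) fun q => ?_
      simp only [Finset.mem_filter, Finset.mem_univ, true_and, Equiv.prodComm_apply,
        Prod.fst_swap, Prod.snd_swap]
      omega
    rw [e, card_filter_add_eq, abs_of_nonpos (by omega)]
    omega

theorem three_mul_sum_abs_sub (M : ℕ) :
    3 * ∑ a ∈ Finset.range M, ∑ c ∈ Finset.range M, |(a : ℤ) - c| = (M : ℤ) ^ 3 - M := by
  have tri : ∀ n : ℕ, 2 * ∑ a ∈ Finset.range n, ((n : ℤ) - a) = n ^ 2 + n := by
    intro n
    induction n with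
    | zero => simp
    | succ n ih =>
      have : ∑ a ∈ Finset.range n, (((n + 1 : ℕ) : ℤ) - a) =
          ∑ a ∈ Finset.range n, ((n : ℤ) - a) + n := by
        have h (a : ℕ) : (((n + 1 : ℕ) : ℤ) - a) = ((n : ℤ) - a) + 1 := by
          push_cast
          ring
        simp only [h, Finset.sum_add_distrib]
        simp
      rw [Finset.sum_range_succ, this]
      push_cast
      linarith
  induction M with
  | zero => simp
  | succ M ih =>
    simp only [Finset.sum_range_succ, Finset.sum_add_distrib]
    have h1 : ∑ a ∈ Finset.range M, |(a : ℤ) - (M : ℕ)| = ∑ a ∈ Finset.range M, ((M : ℤ) - a) := by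
      refine Finset.sum_congr rfl fun a ha => ?_
      rw [Finset.mem_range] at ha
      rw [abs_of_nonpos (by omega)]
      ring
    have h2 : ∑ a ∈ Finset.range M, |((M : ℕ) : ℤ) - a| =
        ∑ a ∈ Finset.range M, ((M : ℤ) - a) := by
      refine Finset.sum_congr rfl fun a ha => ?_
      rw [Finset.mem_range] at ha
      rw [abs_of_nonneg (by omega)]
    rw [h1, h2, sub_self, abs_zero]
    have := tri M
    push_cast
    linarith

/-- The number of additive quadruples in `{0, …, M - 1}`. -/
theorem three_mul_card_additive_quadruples (M : ℕ) :
    3 * (Finset.univ.filter fun q : (Fin M × Fin M) × (Fin M × Fin M) =>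
      (q.1.1 : ℕ) + q.2.1 = q.1.2 + q.2.2).card = M * (2 * M ^ 2 + 1) := by
  have h : ((Finset.univ.filter fun q : (Fin M × Fin M) × (Fin M × Fin M) =>
      (q.1.1 : ℕ) + q.2.1 = q.1.2 + q.2.2).card : ℤ) =
      ∑ a ∈ Finset.range M, ∑ c ∈ Finset.range M, ((M : ℤ) - |(a : ℤ) - c|) := by
    rw [Finset.card_filter, Fintype.sum_prod_type, Fintype.sum_prod_type]
    rw [← Fin.sum_univ_eq_sum_range
      (fun a => ∑ c ∈ Finset.range M, ((M : ℤ) - |(a : ℤ) - c|))]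
    push_cast
    refine Finset.sum_congr rfl fun a _ => ?_
    rw [← Fin.sum_univ_eq_sum_range (fun c => ((M : ℤ) - |((a : ℕ) : ℤ) - c|))]
    refine Finset.sum_congr rfl fun c _ => ?_
    rw [← card_filter_add_eq_add, Finset.card_filter]
    push_cast
    rfl
  have h3 := three_mul_sum_abs_sub M
  simp only [Finset.sum_sub_distrib, Finset.sum_const, Finset.card_range, nsmul_eq_mul] at h
  rw [← Nat.cast_inj (R := ℤ), Nat.cast_mul, h]
  push_cast
  linarith

/-- The `Fin M` parts form an additive quadruple; of the four shifts three are free and the last is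
determined, whence `Z ^ 3`. -/
theorem three_mul_card_closing_quadruples (M Z : ℕ) [NeZero Z] :
    3 * (Finset.univ.filter fun f : Fin 4 → Fin M × ZMod Z =>
      ((f 0).1 : ℕ) + (f 1).1 = (f 2).1 + (f 3).1 ∧
        (f 0).2 + (f 1).2 = (f 2).2 + (f 3).2).card = M * (2 * M ^ 2 + 1) * Z ^ 3 := by
  have h : (Finset.univ.filter fun f : Fin 4 → Fin M × ZMod Z =>
      ((f 0).1 : ℕ) + (f 1).1 = (f 2).1 + (f 3).1 ∧
        (f 0).2 + (f 1).2 = (f 2).2 + (f 3).2).card =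
      ((Finset.univ.filter fun q : (Fin M × Fin M) × (Fin M × Fin M) =>
        (q.1.1 : ℕ) + q.2.1 = q.1.2 + q.2.2) ×ˢ
          (Finset.univ : Finset (ZMod Z × ZMod Z × ZMod Z))).card := by
    refine Finset.card_nbij'
      (fun f => ((((f 0).1, (f 2).1), ((f 1).1, (f 3).1)), ((f 0).2, (f 1).2, (f 2).2)))
      (fun r => ![(r.1.1.1, r.2.1), (r.1.2.1, r.2.2.1), (r.1.1.2, r.2.2.2),
        (r.1.2.2, r.2.1 + r.2.2.1 - r.2.2.2)]) ?_ ?_ ?_ ?_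
    · intro f hf
      simp at hf ⊢
      exact hf.1
    · intro r hr
      simp at hr ⊢
      exact hr
    · intro f hf
      simp only [Finset.coe_filter, Finset.mem_univ, true_and, Set.mem_ofPred_eq] at hf
      funext i
      fin_cases i
      · rfl
      · rfl
      · rfl
      · simp [hf.2]
    · intro r hr
      rfl
  rw [h, Finset.card_product, ← mul_assoc, three_mul_card_additive_quadruples]
  simp only [Finset.card_univ, Fintype.card_prod, ZMod.card]
  ring

theorem card_filter_mem_powersetCard_two (n : ℕ) (i : Fin n) :
    ((Finset.powersetCard 2 Finset.univ).filter fun s : Finset (Fin n) => i ∈ s).card = n - 1 := by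
  have h := Finset.card_filter_add_card_filter_not
    (s := Finset.powersetCard 2 (Finset.univ : Finset (Fin n))) fun s : Finset (Fin n) => i ∈ s
  have h2 : ((Finset.powersetCard 2 Finset.univ).filter fun s : Finset (Fin n) => i ∉ s) =
      Finset.powersetCard 2 (Finset.univ.erase i) := by
    ext s
    simp only [Finset.mem_filter, Finset.mem_powersetCard, Finset.subset_erase]
    tauto
  rw [h2, Finset.card_powersetCard, Finset.card_powersetCard,
    Finset.card_erase_of_mem (Finset.mem_univ _), Finset.card_univ, Fintype.card_fin] at h
  obtain ⟨k, rfl⟩ : ∃ k, n = k + 1 := ⟨n - 1, by have := i.2; omega⟩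
  have := Nat.choose_succ_succ k 1
  simp at h this ⊢
  omega

/-- By complement, C(n,2) - C(n-2,2) = 2n - 3; these are the two factors of Δ. -/
theorem card_filter_not_disjoint_powersetCard_two (n : ℕ) {s : Finset (Fin n)} (hs : s.card = 2) :
    ((Finset.powersetCard 2 Finset.univ).filter fun t : Finset (Fin n) => ¬ Disjoint s t).card =
      2 * n - 3 := by
  have h := Finset.card_filter_add_card_filter_not
    (s := Finset.powersetCard 2 (Finset.univ : Finset (Fin n)))
    fun t : Finset (Fin n) => Disjoint s t
  have h2 : ((Finset.powersetCard 2 Finset.univ).filter fun t : Finset (Fin n) => Disjoint s t) =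
      Finset.powersetCard 2 sᶜ := by
    ext t
    simp only [Finset.mem_filter, Finset.mem_powersetCard, Finset.subset_univ, true_and,
      Finset.subset_compl_iff_disjoint_left]
    tauto
  rw [h2, Finset.card_powersetCard, Finset.card_powersetCard, Finset.card_compl, hs,
    Finset.card_univ, Fintype.card_fin] at h
  obtain ⟨k, rfl⟩ : ∃ k, n = k + 2 := ⟨n - 2, by
    have := Finset.card_le_univ s
    rw [hs, Fintype.card_fin] at this
    omega⟩
  have h3 : (k + 2).choose 2 = _ := Nat.choose_succ_succ (k + 1) 1
  have h4 := Nat.choose_succ_succ k 1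
  rw [Nat.choose_one_right] at h3 h4
  simp only [Nat.add_sub_cancel, Nat.succ_eq_add_one, Nat.reduceAdd] at h h3 h4
  omega

end Counting

/-! ### From Tanner graph cycles to closing equations and their events. -/

namespace QCSC

variable {γ κ m Z : ℕ}

/-- The equations for the candidate on rows `i₁, i₂` and columns `j₁, j₂` to lift to a 4-cycle. -/
def Closes (ω : Fin γ × Fin κ → Fin (m + 1) × ZMod Z) (i₁ i₂ : Fin γ) (j₁ j₂ : Fin κ) : Prop :=
  ((ω (i₁, j₁)).1 : ℕ) + (ω (i₂, j₂)).1 = (ω (i₁, j₂)).1 + (ω (i₂, j₁)).1 ∧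
    (ω (i₁, j₁)).2 + (ω (i₂, j₂)).2 = (ω (i₁, j₂)).2 + (ω (i₂, j₁)).2

theorem circulantShift_pow [NeZero Z] (k : ℕ) (x y : ZMod Z) :
    (circulantShift Z ^ k) x y = if x = y + k then 1 else 0 := by
  induction k generalizing x y with
  | zero => simp [Matrix.one_apply]
  | succ k ih =>
    rw [pow_succ, Matrix.mul_apply, Finset.sum_eq_single (y + 1)]
    · rw [ih]
      simp [circulantShift, add_comm, add_left_comm]
    · intro z _ hz
      simp [circulantShift, hz]
    · simp

theorem shifts_of_parityCheck_eq_one [NeZero Z] {Lc : ℕ} {P : PartitionMatrix γ κ m}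
    {L : LiftingMatrix γ κ Z} {a : CheckNode γ m Z Lc} {b : VarNode κ Z Lc}
    (h : parityCheck Lc P L a b = 1) :
    (a.1.1 : ℕ) = b.1.1 + P a.1.2 b.1.2 ∧ a.2 = b.2 + L a.1.2 b.1.2 := by
  have h' : coupledProtograph Lc P a.1 b.1 *
      (circulantShift Z ^ (L a.1.2 b.1.2).val) a.2 b.2 = 1 := h
  have h1 : coupledProtograph Lc P a.1 b.1 ≠ 0 := by
    intro h0
    simp [h0] at h'
  have h2 : (circulantShift Z ^ (L a.1.2 b.1.2).val) a.2 b.2 ≠ 0 := by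
    intro h0
    simp [h0] at h'
  constructor
  · rw [coupledProtograph, Matrix.of_apply] at h1
    obtain ⟨l, -, hl⟩ := Finset.exists_ne_zero_of_sum_ne_zero h1
    simp only [componentMatrix, Matrix.of_apply] at hl
    split_ifs at hl with h3 h4
    · rw [h3, h4]
    · exact absurd rfl hl
    · exact absurd rfl hl
  · rw [circulantShift_pow] at h2
    by_contra hne
    exact h2 (if_neg (by simpa using hne))

theorem tannerGraph_adj_inl_inr {R C : Type*} {H : Matrix R C (ZMod 2)} {r : R} {c : C} :
    (tannerGraph H).Adj (Sum.inl r) (Sum.inr c) ↔ H r c = 1 := by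
  simp [tannerGraph, SimpleGraph.fromRel_adj]

/-- Each edge gives the difference of its endpoints' block indices and of their circulant indices.
In the alternating sum around the walk all these indices cancel, leaving the two equations. This
direction holds for every `Lc`, and a lower bound needs no other. -/
theorem FourCycle.Active.closes [NeZero Z] {Lc : ℕ}
    {ω : Fin γ × Fin κ → Fin (m + 1) × ZMod Z} {c : FourCycle γ κ}
    (h : c.Active Lc (Matrix.of fun i j => (ω (i, j)).1 : PartitionMatrix γ κ m)
      (Matrix.of fun i j => (ω (i, j)).2)) :
    Closes ω c.i₁ c.i₂ c.j₁ c.j₂ := by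
  obtain ⟨v, w, -, hw⟩ := h
  have key : ∀ (a : CheckNode γ m Z Lc) (b : VarNode κ Z Lc),
      (tannerGraph (parityCheck Lc (Matrix.of fun i j => (ω (i, j)).1 : PartitionMatrix γ κ m)
        (Matrix.of fun i j => (ω (i, j)).2))).Adj (Sum.inl a) (Sum.inr b) →
      (a.1.1 : ℕ) = b.1.1 + (ω (a.1.2, b.1.2)).1 ∧ a.2 = b.2 + (ω (a.1.2, b.1.2)).2 :=
    fun a b hab => shifts_of_parityCheck_eq_one (tannerGraph_adj_inl_inr.1 hab)
  match w, hw with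
  | .cons (v := x₁) h₁ (.cons (v := x₂) h₂ (.cons (v := x₃) h₃ (.cons h₄ .nil))), hw =>
    simp only [SimpleGraph.Walk.support_cons, SimpleGraph.Walk.support_nil, List.map_cons,
      List.map_nil, List.cons.injEq, and_true] at hw
    obtain ⟨e₀, e₁, e₂, e₃, -⟩ := hw
    rcases v with _ | b₁ <;> simp [toBase] at e₀
    rcases x₁ with a₁ | _ <;> simp [toBase] at e₁
    rcases x₂ with _ | b₂ <;> simp [toBase] at e₂
    rcases x₃ with a₂ | _ <;> simp [toBase] at e₃
    have k₁ := key _ _ h₁.symm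
    have k₂ := key _ _ h₂
    have k₃ := key _ _ h₃.symm
    have k₄ := key _ _ h₄
    rw [e₀, e₁] at k₁
    rw [e₂, e₁] at k₂
    rw [e₂, e₃] at k₃
    rw [e₀, e₃] at k₄
    refine ⟨by omega, ?_⟩
    linear_combination k₂.2 + k₄.2 - k₁.2 - k₃.2
  | .nil, hw => simp at hw
  | .cons _ .nil, hw => simp at hw
  | .cons _ (.cons _ .nil), hw => simp at hw
  | .cons _ (.cons _ (.cons _ .nil)), hw => simp at hw
  | .cons _ (.cons _ (.cons _ (.cons _ (.cons _ _)))), hw => simp at hw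

open Classical in
/-- The assignments for which some candidate on the rows `c.1` and the columns `c.2` closes. -/
noncomputable def closedOn (m Z : ℕ) [NeZero Z] (c : Finset (Fin γ) × Finset (Fin κ)) :
    Finset (Fin γ × Fin κ → Fin (m + 1) × ZMod Z) :=
  Finset.univ.filter fun ω => ∃ i₁ ∈ c.1, ∃ i₂ ∈ c.1, ∃ j₁ ∈ c.2, ∃ j₂ ∈ c.2,
    i₁ ≠ i₂ ∧ j₁ ≠ j₂ ∧ Closes ω i₁ i₂ j₁ j₂

theorem mem_closedOn [NeZero Z] {c : Finset (Fin γ) × Finset (Fin κ)}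
    {ω : Fin γ × Fin κ → Fin (m + 1) × ZMod Z} :
    ω ∈ closedOn m Z c ↔ ∃ i₁ ∈ c.1, ∃ i₂ ∈ c.1, ∃ j₁ ∈ c.2, ∃ j₂ ∈ c.2,
      i₁ ≠ i₂ ∧ j₁ ≠ j₂ ∧ Closes ω i₁ i₂ j₁ j₂ := by
  simp [closedOn]

/-- The candidates, as pairs of a set of two rows and a set of two columns. -/
def candidates (γ κ : ℕ) : Finset (Finset (Fin γ) × Finset (Fin κ)) :=
  Finset.powersetCard 2 Finset.univ ×ˢ Finset.powersetCard 2 Finset.univ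

theorem mem_candidates {c : Finset (Fin γ) × Finset (Fin κ)} :
    c ∈ candidates γ κ ↔ c.1.card = 2 ∧ c.2.card = 2 := by
  simp [candidates, Finset.mem_powersetCard]

theorem card_candidates : (candidates γ κ).card = γ.choose 2 * κ.choose 2 := by
  simp [candidates]

/-- Swapping the rows or the columns exchanges the two sides of each equation, so all orderings of a
candidate give one event. -/
theorem mem_closedOn_pair [NeZero Z] {i₁ i₂ : Fin γ} {j₁ j₂ : Fin κ} (hi : i₁ ≠ i₂) (hj : j₁ ≠ j₂)
    {ω : Fin γ × Fin κ → Fin (m + 1) × ZMod Z} :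
    ω ∈ closedOn m Z ({i₁, i₂}, {j₁, j₂}) ↔ Closes ω i₁ i₂ j₁ j₂ := by
  rw [mem_closedOn]
  constructor
  · rintro ⟨a, ha, b, hb, c, hc, d, hd, hab, hcd, h, h'⟩
    simp only [Finset.mem_insert, Finset.mem_singleton] at ha hb hc hd
    rcases ha with rfl | rfl <;> rcases hb with rfl | rfl <;>
      first
      | exact absurd rfl hab
      | rcases hc with rfl | rfl <;> rcases hd with rfl | rfl <;>
          first
          | exact absurd rfl hcd
          | exact ⟨by omega, by linear_combination h'⟩
          | exact ⟨by omega, by linear_combination -h'⟩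
  · intro h
    exact ⟨i₁, by simp, i₂, by simp, j₁, by simp, j₂, by simp, hi, hj, h⟩

/-- The probability that a given candidate closes. -/
theorem card_closedOn [NeZero Z] {c : Finset (Fin γ) × Finset (Fin κ)} (hc : c ∈ candidates γ κ) :
    ((closedOn m Z c).card : ℝ) =
      (2 * (m : ℝ) ^ 2 + 4 * m + 3) / (3 * ((m : ℝ) + 1) ^ 3 * Z) *
        Fintype.card (Fin γ × Fin κ → Fin (m + 1) × ZMod Z) := by
  classical
  obtain ⟨s, t⟩ := c
  obtain ⟨hs, ht⟩ := mem_candidates.1 hc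
  obtain ⟨i₁, i₂, hi, rfl⟩ := Finset.card_eq_two.1 hs
  obtain ⟨j₁, j₂, hj, rfl⟩ := Finset.card_eq_two.1 ht
  have hinj : Function.Injective ![(i₁, j₁), (i₂, j₂), (i₁, j₂), (i₂, j₁)] := by
    intro a b
    fin_cases a <;> fin_cases b <;> simp [hi, hj, hi.symm, hj.symm]
  have h := card_filter_comp_mul_card (α := Fin (m + 1) × ZMod Z) hinj fun f =>
    ((f 0).1 : ℕ) + (f 1).1 = (f 2).1 + (f 3).1 ∧ (f 0).2 + (f 1).2 = (f 2).2 + (f 3).2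
  have h3 := three_mul_card_closing_quadruples (m + 1) Z
  have he : closedOn m Z ({i₁, i₂}, {j₁, j₂}) =
      Finset.univ.filter fun ω : Fin γ × Fin κ → Fin (m + 1) × ZMod Z =>
        (fun f : Fin 4 → Fin (m + 1) × ZMod Z =>
          ((f 0).1 : ℕ) + (f 1).1 = (f 2).1 + (f 3).1 ∧ (f 0).2 + (f 1).2 = (f 2).2 + (f 3).2)
        (ω ∘ ![(i₁, j₁), (i₂, j₂), (i₁, j₂), (i₂, j₁)]) := by
    ext ω
    rw [mem_closedOn_pair hi hj, Finset.mem_filter]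
    simp [Closes]
  rw [← he] at h
  have hZ : (Z : ℝ) ≠ 0 := Nat.cast_ne_zero.2 (NeZero.ne Z)
  have hm : (m : ℝ) + 1 ≠ 0 := by positivity
  have hcard : Fintype.card (Fin 4 → Fin (m + 1) × ZMod Z) = ((m + 1) * Z) ^ 4 := by
    simp [ZMod.card]
  rw [hcard] at h
  have h' := congrArg (Nat.cast (R := ℝ)) h
  have h3' := congrArg (Nat.cast (R := ℝ)) h3
  push_cast at h' h3'
  rw [div_mul_eq_mul_div, eq_div_iff (by positivity)]
  -- This factor completes `(m + 1) ^ 3 * Z` to `((m + 1) * Z) ^ 4`, the number of assignments to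
  -- four cells.
  refine mul_right_cancel₀ (b := ((m : ℝ) + 1) * Z ^ 3) (by positivity) ?_
  linear_combination 3 * h' + (Fintype.card (Fin γ × Fin κ → Fin (m + 1) × ZMod Z) : ℝ) * h3'

theorem closedOn_dependsOnlyOn [NeZero Z] (c : Finset (Fin γ) × Finset (Fin κ)) :
    DependsOnlyOn (closedOn m Z c) ↑(c.1 ×ˢ c.2) := by
  intro f g hfg hf
  rw [mem_closedOn] at hf ⊢
  obtain ⟨i₁, hi₁, i₂, hi₂, j₁, hj₁, j₂, hj₂, hi, hj, h⟩ := hf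
  refine ⟨i₁, hi₁, i₂, hi₂, j₁, hj₁, j₂, hj₂, hi, hj, ?_⟩
  rw [Closes] at h ⊢
  have e : ∀ i ∈ c.1, ∀ j ∈ c.2, g (i, j) = f (i, j) := fun i hi j hj =>
    (hfg (i, j) (Finset.mem_coe.2 (Finset.mem_product.2 ⟨hi, hj⟩))).symm
  rwa [e i₁ hi₁ j₁ hj₁, e i₁ hi₁ j₂ hj₂, e i₂ hi₂ j₁ hj₁, e i₂ hi₂ j₂ hj₂]

/-- Avoiding `S` depends only on cells outside `c`, so conditioning on it leaves the probability
unchanged. This is the independence input of both local lemmas. -/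
theorem card_closedOn_inter_avoiding [NeZero Z] {c : Finset (Fin γ) × Finset (Fin κ)}
    (hc : c ∈ candidates γ κ) {S : Finset (Finset (Fin γ) × Finset (Fin κ))}
    (hS : ∀ d ∈ S, Disjoint (c.1 ×ˢ c.2) (d.1 ×ˢ d.2)) :
    ((closedOn m Z c ∩ avoiding (closedOn m Z) S).card : ℝ) =
      (2 * (m : ℝ) ^ 2 + 4 * m + 3) / (3 * ((m : ℝ) + 1) ^ 3 * Z) *
        (avoiding (closedOn m Z) S).card := by
  have hB : DependsOnlyOn (avoiding (closedOn m Z) S) (↑(c.1 ×ˢ c.2))ᶜ := by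
    intro f g hfg hf
    rw [mem_avoiding] at hf ⊢
    refine fun d hd hg => hf d hd (closedOn_dependsOnlyOn d g f (fun i hi => ?_) hg)
    exact (hfg i fun hi' => Finset.disjoint_left.1 (hS d hd) hi' hi).symm
  have h := congrArg (Nat.cast (R := ℝ))
    (card_inter_mul_card_of_dependsOnlyOn (closedOn_dependsOnlyOn (m := m) (Z := Z) c) hB)
  rw [Nat.cast_mul, Nat.cast_mul, card_closedOn hc] at h
  have hpos : (Fintype.card (Fin γ × Fin κ → Fin (m + 1) × ZMod Z) : ℝ) ≠ 0 :=
    Nat.cast_ne_zero.2 Fintype.card_ne_zero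
  refine mul_right_cancel₀ hpos ?_
  rw [h]
  ring

theorem card_avoiding_le_ncard_feasiblePairs (γ κ m Z Lc : ℕ) [NeZero Z] :
    (avoiding (closedOn m Z) (candidates γ κ)).card ≤ (feasiblePairs γ κ m Z Lc).ncard := by
  rw [← Set.ncard_coe_finset]
  refine Set.ncard_le_ncard_of_injOn
    (fun ω => (Matrix.of fun i j => (ω (i, j)).1, Matrix.of fun i j => (ω (i, j)).2)) ?_ ?_
    (Set.toFinite _)
  · intro ω hω c hc
    refine mem_avoiding.1 (Finset.mem_coe.1 hω) ({c.i₁, c.i₂}, {c.j₁, c.j₂}) ?_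
      ((mem_closedOn_pair c.hi c.hj).2 hc.closes)
    exact mem_candidates.2 ⟨Finset.card_pair c.hi, Finset.card_pair c.hj⟩
  · intro ω _ ω' _ h
    rw [Prod.mk.injEq] at h
    funext ⟨i, j⟩
    exact Prod.ext (congrFun (congrFun h.1 i) j) (congrFun (congrFun h.2 i) j)

theorem card_filter_mem_candidates (q : Fin γ × Fin κ) :
    ((candidates γ κ).filter fun c => q ∈ c.1 ×ˢ c.2).card = (γ - 1) * (κ - 1) := by
  rw [← card_filter_mem_powersetCard_two γ q.1, ← card_filter_mem_powersetCard_two κ q.2,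
    ← Finset.card_product]
  congr 1
  ext c
  simp only [candidates, Finset.mem_filter, Finset.mem_product]
  tauto

/-- Sharing a row and a column means sharing a cell; the Δ candidates meeting `c` this way include
`c` itself, hence the `- 1`. -/
theorem card_filter_adjacent_candidates {c : Finset (Fin γ) × Finset (Fin κ)}
    (hc : c ∈ candidates γ κ) :
    (((candidates γ κ).erase c).filter fun d => ¬ Disjoint c.1 d.1 ∧ ¬ Disjoint c.2 d.2).card =
      Delta γ κ - 1 := by
  obtain ⟨h1, h2⟩ := mem_candidates.1 hc
  rw [Finset.filter_erase, Finset.card_erase_of_mem]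
  · rw [Delta, ← card_filter_not_disjoint_powersetCard_two γ h1,
      ← card_filter_not_disjoint_powersetCard_two κ h2, ← Finset.card_product]
    congr 2
    ext d
    simp only [candidates, Finset.mem_filter, Finset.mem_product]
    tauto
  · refine Finset.mem_filter.2 ⟨hc, ?_, ?_⟩ <;> rw [disjoint_self, Finset.bot_eq_empty] <;>
      rintro h0 <;> simp [h0] at h1 h2

end QCSC

/-! ### The two regimes of the bound. -/

open QCSC in
theorem corollary1 (γ κ m Z Lc : ℕ) [NeZero Z] (hγκ : γ + κ < γ * κ)
    (h : (2 * (m : ℝ) ^ 2 + 4 * m + 3) / (3 * ((m : ℝ) + 1) ^ 3 * Z) ≤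
      max (QCSC.thresholdI γ κ) (QCSC.thresholdII γ κ)) :
    ((Z : ℝ) * ((m : ℝ) + 1)) ^ (γ * κ) *
        (if QCSC.thresholdI γ κ > QCSC.thresholdII γ κ then
          (1 - 2 / (QCSC.Delta γ κ : ℝ)) ^ (γ.choose 2 * κ.choose 2)
        else
          (1 - ((γ : ℝ) * κ - γ - κ + 1) / (4 * ((γ : ℝ) * κ - γ - κ))) ^ (γ * κ)) ≤
      ((QCSC.feasiblePairs γ κ m Z Lc).ncard : ℝ) := by
  have hcard : (Fintype.card (Fin γ × Fin κ → Fin (m + 1) × ZMod Z) : ℝ) =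
      ((Z : ℝ) * ((m : ℝ) + 1)) ^ (γ * κ) := by
    simp [ZMod.card, mul_comm]
  have hγ : 2 ≤ γ := by
    by_contra! hlt
    interval_cases γ <;> omega
  have hκ : 2 ≤ κ := by
    by_contra! hlt
    interval_cases κ <;> omega
  refine le_trans ?_ (Nat.cast_le.2 (card_avoiding_le_ncard_feasiblePairs γ κ m Z Lc))
  rw [← hcard, mul_comm]
  split_ifs with hI
  · rw [max_eq_left hI.le] at h
    have hΔ : 2 ≤ Delta γ κ := by
      obtain ⟨a, rfl⟩ := Nat.exists_eq_add_of_le hγ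
      obtain ⟨b, rfl⟩ := Nat.exists_eq_add_of_le hκ
      have e : Delta (2 + a) (2 + b) = (2 * a + 1) * (2 * b + 1) := by
        rw [Delta]
        congr 1 <;> omega
      rw [e]
      nlinarith
    have hΔ' : (2 : ℝ) ≤ Delta γ κ := by exact_mod_cast hΔ
    have hΔ0 : (0 : ℝ) < Delta γ κ := by linarith
    have h2 : 2 / (Delta γ κ : ℝ) ≤ 1 := (div_le_one hΔ0).2 hΔ'
    have h12 : 1 / (Delta γ κ : ℝ) ≤ 2 / (Delta γ κ : ℝ) := by gcongr; norm_num
    have hp : (2 * (m : ℝ) ^ 2 + 4 * m + 3) / (3 * ((m : ℝ) + 1) ^ 3 * Z) ≤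
        1 / (Delta γ κ : ℝ) * (1 - 1 / (Delta γ κ : ℝ)) ^ (Delta γ κ - 1) := by
      refine h.trans_eq ?_
      rw [thresholdI]
      rw [one_sub_div hΔ0.ne', div_pow, div_mul_div_comm, one_mul, ← pow_succ',
        Nat.sub_add_cancel (by omega)]
    have hlll := symmetric_local_lemma (closedOn m Z)
      (fun c d : Finset (Fin γ) × Finset (Fin κ) => ¬ Disjoint c.1 d.1 ∧ ¬ Disjoint c.2 d.2)
      (candidates γ κ) (d := Delta γ κ - 1) (x := 1 / Delta γ κ) (by positivity) (by linarith) hp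
      (fun c hc => (card_filter_adjacent_candidates hc).le)
      fun c hc S _ hS => (card_closedOn_inter_avoiding hc fun d hd => by
        rw [Finset.disjoint_product]
        have := hS d hd
        tauto).le
    rw [card_candidates] at hlll
    -- The lemma gives the stronger base `1 - 1/Δ`; since `Δ ≥ 2`, the base `1 - 2/Δ` is nonnegative
    -- and the powers compare.
    refine le_trans ?_ hlll
    gcongr
  · rw [max_eq_right (not_lt.1 hI)] at h
    -- Here `n + 1` is γκ - γ - κ, renamed `N` below, and (γ-1)(κ-1) exceeds it by one.
    obtain ⟨n, hn⟩ := Nat.exists_eq_add_of_lt hγκ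
    have hn1 : (γ - 1) * (κ - 1) = (n + 1) + 1 := by
      obtain ⟨a, rfl⟩ := Nat.exists_eq_add_of_le hγ
      obtain ⟨b, rfl⟩ := Nat.exists_eq_add_of_le hκ
      have : (2 + a - 1) * (2 + b - 1) = (a + 1) * (b + 1) := by congr 1 <;> omega
      rw [this]
      linarith
    have hnR : (γ : ℝ) * κ - γ - κ = (n + 1 : ℕ) := by
      have := congrArg (Nat.cast (R := ℝ)) hn
      push_cast at this ⊢
      linarith
    rw [thresholdII, hnR] at h
    rw [hnR]
    have hpos : (1 : ℝ) ≤ ((n + 1 : ℕ) : ℝ) := by exact_mod_cast Nat.le_add_left 1 n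
    generalize n + 1 = N at *
    have hp : (2 * (m : ℝ) ^ 2 + 4 * m + 3) / (3 * ((m : ℝ) + 1) ^ 3 * Z) ≤
        1 / (4 * N) * (1 - N * (1 / (4 * (N : ℝ)))) ^ 3 := by
      refine h.trans_eq ?_
      field_simp
      norm_num
    have hlll := clique_local_lemma (closedOn m Z)
      (fun c : Finset (Fin γ) × Finset (Fin κ) => c.1 ×ˢ c.2) (candidates γ κ)
      (n := N) (k := 3) (x := 1 / (4 * N)) (by positivity)
      (by rw [mul_one_div, div_le_one (by positivity)]; linarith) hp
      (fun c hc => by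
        obtain ⟨h1, h2⟩ := mem_candidates.1 hc
        rw [Finset.card_product, h1, h2])
      (fun q => (card_filter_mem_candidates q).trans hn1 |>.le)
      fun c hc S _ hS => (card_closedOn_inter_avoiding hc hS).le
    rw [mul_one_div, Fintype.card_prod, Fintype.card_fin, Fintype.card_fin] at hlll
    exact hlll
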